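/- For a stream of $m$ votes, each a ranking (permutation) of $n$ candidates, the maximin score of a candidate $i$ is the minimum, over all candidates $j\ne i$, of the number of votes that rank $i$ ahead of $j$. A randomized one-pass algorithm with $s$ bits of memory solves $\varepsilon$-maximin on streams of length $m$ with error probability $\delta$ if, reading the votes one at a time and carrying only its $s$ memory bits from one vote to the next, on every stream of $m$ votes it outputs, with probability at least $1-\delta$ over its coin tosses, a real number that differs from the maximum, over all candidates, of the maximin score by at most $\varepsilon m$. Theorem. Every one-pass algorithm for $\varepsilon$-maximin with constant success probability needs $\Omega(n/\varepsilon^2)$ bits of memory. Precisely: for every $\delta\in(0,1)$ there are constants $c>0$ and $\varepsilon_0>0$, depending only on $\delta$, such that for all $0<\varepsilon\le\varepsilon_0$ and all integers $n\ge 1/\varepsilon^2$ and $m\ge 1/\varepsilon^2$, every randomized one-pass algorithm that solves $\varepsilon$-maximin on streams of $m$ rankings of $n$ candidates with error probability $\delta$ uses $s\ge c\,n/\varepsilon^2$ bits of memory. This holds even if $m$ is known in advance and the algorithm has free access to its random coins and to the number of votes read so far. -/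

import Mathlib

namespace MaximinStream

/-- A vote (ranking) over the candidates `Fin n`: the permutation sends each candidate to its
position, position `0` being the top. -/
abbrev Vote (n : ℕ) : Type := Equiv.Perm (Fin n)

/-- Candidate `i` is ranked ahead of candidate `j` in the vote `v`. -/
def Ahead {n : ℕ} (v : Vote n) (i j : Fin n) : Prop := v i < v j

instance {n : ℕ} (v : Vote n) (i j : Fin n) : Decidable (Ahead v i j) :=
  inferInstanceAs (Decidable (v i < v j))

/-- The number of votes of the stream in which `i` is ranked ahead of `j`. -/
def pairwiseCount {n : ℕ} (σ : List (Vote n)) (i j : Fin n) : ℕ :=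
  σ.countP (fun v => decide (Ahead v i j))

/-- The maximin score of `i`: the minimum, over all `j ≠ i`, of the number of votes in which `i`
is ranked ahead of `j`.  (There is such a `j` as soon as `2 ≤ n`.) -/
noncomputable def maximinScore {n : ℕ} (σ : List (Vote n)) (i : Fin n) : ℕ :=
  ⨅ j : {j : Fin n // j ≠ i}, pairwiseCount σ i j

/-- The maximum maximin score of a candidate in the stream. -/
noncomputable def maxMaximinScore {n : ℕ} (σ : List (Vote n)) : ℕ :=
  Finset.univ.sup (fun i : Fin n => maximinScore σ i)

/-- The contents of a memory of `s` bits. -/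
abbrev Memory (s : ℕ) : Type := Fin s → Bool

/-- A randomized one-pass streaming algorithm with `s` bits of memory, for streams of items of
type `V`, with real output.  A point `ω : Ω` is the outcome of all the coin tosses.  Only the
memory contents carried from one item to the next are charged for: the coins, the number of items
read so far, and the work space used while a single item is processed are free, and the update
rules are arbitrary functions.  In particular every algorithm that tosses fresh coins at each
step is of this form. -/
structure OnePassAlg (Ω : Type*) [MeasurableSpace Ω] (V : Type*) (s : ℕ) where
  /-- The initial memory contents. -/
  init : Ω → Memory s
  /-- `step ω t q x` is the memory after reading the item `x`, when `t` items have been read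
  before and the memory contents are `q`. -/
  step : Ω → ℕ → Memory s → V → Memory s
  /-- The output, computed from the final memory contents. -/
  out : Ω → Memory s → ℝ
  measurable_init : Measurable init
  measurable_step : ∀ t q x, Measurable (fun ω => step ω t q x)
  measurable_out : ∀ q, Measurable (fun ω => out ω q)

namespace OnePassAlg

variable {Ω : Type*} [MeasurableSpace Ω] {V : Type*} {s : ℕ}

/-- The memory after reading a list of items, starting from memory `q` with `t` items already
read. -/
def runFrom (A : OnePassAlg Ω V s) (ω : Ω) : ℕ → Memory s → List V → Memory s
  | _, q, [] => q
  | t, q, x :: xs => runFrom A ω (t + 1) (A.step ω t q x) xs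

/-- The output of the algorithm on a stream. -/
def output (A : OnePassAlg Ω V s) (ω : Ω) (σ : List V) : ℝ :=
  A.out ω (A.runFrom ω 0 (A.init ω) σ)

end OnePassAlg

/-- The algorithm solves `ε`-maximin on streams of `m` votes over `n` candidates with error
probability at most `δ`: on every such stream, with probability at least `1 - δ` over its coins,
it outputs the maximum maximin score up to an additive error of `ε m`. -/
def SolvesMaximin {Ω : Type*} [MeasurableSpace Ω] (μ : MeasureTheory.Measure Ω) {n s : ℕ}
    (A : OnePassAlg Ω (Vote n) s) (m : ℕ) (ε δ : ℝ) : Prop :=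
  ∀ σ : List (Vote n), σ.length = m →
    1 - δ ≤ μ.real {ω | |A.output ω σ - (maxMaximinScore σ : ℝ)| ≤ ε * (m : ℝ)}

end MaximinStream

/-! The memory must store a long word whose letters can be queried. The candidates are split into
`γ` left ones, with `γ` of order `1/ε²`, and `M ≥ n/2` right ones. Left candidate `a` carries a
fixed sign row `u a`, these rows being orthogonal. Each right candidate carries a word of `γ`
letters over `k = 2^κ` levels, written as a sign vector of length `T` of order `1/ε²` whose inner
product with `u a` is close to `θT` times the level of letter `a`, for most `a` (`exists_code`).
Column votes make each left-right pairwise count affine in such an inner product, and appended query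
votes turn one chosen count into the maximum maximin score (`maxMaximinScore_append_queryVotes`). An
error `εm` is below the resolution of the levels, so for suitably fixed coins the memory after the
data determines at least a fraction `3(1-δ)/4` of the letters on average
(`le_two_pow_of_solvesMaximin`).

When `1-δ ≤ 1/2`, bits can be guessed for free, hence the large alphabet: with `κ(1-δ) ≥ 16`, words
agreeing with a fixed guess in a fraction `(1-δ)/4` of the letters are so rare that about `2^(2Mγ)`
memory states are needed (`le_card_of_agreement`).

For the code, the combination of the rows with coefficients `θ · level` has exactly the right inner
products. Its entries are clipped to `[-1,1]` and rounded greedily to signs. Bessel's inequality, a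
fourth moment bound and Markov's inequality show that at least half of the words lose few letters.
-/

namespace MaximinStream

/-! ### Orthogonal sign rows and rounding to signs -/

/-- The sign `±1` of a bit. -/
def sgn (b : Bool) : ℝ := if b then 1 else -1

lemma sgn_sq (b : Bool) : sgn b ^ 2 = 1 := by cases b <;> norm_num [sgn]

/-- Sylvester's Hadamard matrices. -/
lemma exists_hadamard (r : ℕ) : ∃ H : Matrix (Fin (2 ^ r)) (Fin (2 ^ r)) ℝ,
    (∀ i j, H i j = 1 ∨ H i j = -1) ∧ H.transpose * H = ((2 : ℝ) ^ r) • 1 := by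
  induction r with
  | zero =>
    refine ⟨Matrix.of fun _ _ => 1, fun _ _ => Or.inl rfl, ?_⟩
    ext i j
    have h : i = j := by omega
    subst h
    simp [Matrix.mul_apply]
  | succ r ih =>
    obtain ⟨H, h1, h2⟩ := ih
    let e : Fin (2 ^ r) ⊕ Fin (2 ^ r) ≃ Fin (2 ^ (r + 1)) :=
      finSumFinEquiv.trans (finCongr (by rw [pow_succ]; ring))
    refine ⟨Matrix.reindex e e (Matrix.fromBlocks H H H (-H)), ?_, ?_⟩
    · intro i j
      rcases hi : e.symm i with a | a <;> rcases hj : e.symm j with b | b <;>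
        rcases h1 a b with h | h <;> simp [Matrix.reindex_apply, hi, hj, h]
    · have h3 : (Matrix.fromBlocks H H H (-H)).transpose * Matrix.fromBlocks H H H (-H)
          = ((2 : ℝ) ^ (r + 1)) • 1 := by
        rw [Matrix.fromBlocks_transpose, Matrix.fromBlocks_multiply, ← Matrix.fromBlocks_one,
          Matrix.fromBlocks_smul]
        simp only [Matrix.transpose_neg, Matrix.mul_neg, Matrix.neg_mul, h2, neg_neg,
          add_neg_cancel, smul_zero, ← add_smul]
        congr 2 <;> ring
      rw [Matrix.reindex_apply, Matrix.transpose_submatrix, Matrix.submatrix_mul_equiv, h3]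
      ext i j
      simp [Matrix.one_apply]

/-- `γ` orthogonal rows of signs, together with Bessel's inequality for them. -/
lemma exists_orthogonal_rows (r γ : ℕ) (hγ : γ ≤ 2 ^ r) :
    ∃ u : Fin γ → Fin (2 ^ r) → Bool,
      (∀ a a', ∑ t, sgn (u a t) * sgn (u a' t) = if a = a' then (2 : ℝ) ^ r else 0) ∧
      ∀ z : Fin (2 ^ r) → ℝ, ∑ a, (∑ t, sgn (u a t) * z t) ^ 2 ≤ 2 ^ r * ∑ t, z t ^ 2 := by
  obtain ⟨H, h1, h2⟩ := exists_hadamard r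
  have h3 : H * H.transpose = ((2 : ℝ) ^ r) • 1 := by
    have hne : (2 : ℝ) ^ r ≠ 0 := by positivity
    have : (((2 : ℝ) ^ r)⁻¹ • H.transpose) * H = 1 := by
      rw [Matrix.smul_mul, h2, smul_smul, inv_mul_cancel₀ hne, one_smul]
    -- A one-sided inverse of a square matrix is two-sided, so orthogonal columns give orthogonal
    -- rows.
    have h4 := mul_eq_one_comm.mp this
    rw [Matrix.mul_smul] at h4
    rw [← h4, smul_smul, mul_inv_cancel₀ hne, one_smul]
  let e : Fin γ ↪ Fin (2 ^ r) := Fin.castLEEmb hγ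
  have hs : ∀ i j, sgn (decide (H i j = 1)) = H i j := by
    intro i j
    rcases h1 i j with h | h <;> norm_num [sgn, h]
  refine ⟨fun a t => decide (H (e a) t = 1), fun a a' => ?_, fun z => ?_⟩
  · simp only [hs]
    have := congrFun (congrFun h3 (e a)) (e a')
    rw [Matrix.mul_apply] at this
    simpa [Matrix.one_apply] using this
  · simp only [hs]
    have hall : ∑ i, (∑ t, H i t * z t) ^ 2 = 2 ^ r * ∑ t, z t ^ 2 := by
      have : (H.mulVec z) ⬝ᵥ (H.mulVec z) = 2 ^ r * (z ⬝ᵥ z) := by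
        rw [Matrix.dotProduct_mulVec, Matrix.vecMul_mulVec, h2, Matrix.vecMul_smul,
          Matrix.vecMul_one, smul_dotProduct, smul_eq_mul]
      simpa [dotProduct, Matrix.mulVec, ← sq] using this
    rw [← hall, ← Finset.sum_map Finset.univ e (fun i => (∑ t, H i t * z t) ^ 2)]
    exact Finset.sum_le_sum_of_subset_of_nonneg (Finset.subset_univ _)
      (fun _ _ _ => sq_nonneg _)

/-- Greedy rounding of a point of the cube to a vertex. -/
lemma exists_rounding {A T : Type*} [Fintype A] [Fintype T] [DecidableEq T]
    (u : A → T → Bool) (w : A → ℝ) (z : T → ℝ) (hz : ∀ t, |z t| ≤ 1) :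
    ∃ v : T → Bool, ∑ a, (∑ t, sgn (u a t) * sgn (v t) - w a) ^ 2 ≤
      ∑ a, (∑ t, sgn (u a t) * z t - w a) ^ 2 + Fintype.card A * Fintype.card T := by
  have key : ∀ S : Finset T, ∃ y : T → ℝ, (∀ t ∈ S, ∃ b, y t = sgn b) ∧ (∀ t, t ∉ S → y t = z t) ∧
      ∑ a, (∑ t, sgn (u a t) * y t - w a) ^ 2 ≤
      ∑ a, (∑ t, sgn (u a t) * z t - w a) ^ 2 + Fintype.card A * S.card := by
    intro S
    induction S using Finset.induction_on with
    | empty => exact ⟨z, by simp, by simp, by simp⟩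
    | insert t₀ S ht ih =>
      obtain ⟨y, hy1, hy2, hy3⟩ := ih
      have hyt := hy2 t₀ ht
      let f : ℝ → ℝ := fun c => ∑ a, (∑ t, sgn (u a t) * Function.update y t₀ c t - w a) ^ 2
      have hupd : ∀ a c, ∑ t, sgn (u a t) * Function.update y t₀ c t
          = ∑ t, sgn (u a t) * y t + sgn (u a t₀) * (c - z t₀) := by
        intro a c
        rw [← Finset.add_sum_erase _ _ (Finset.mem_univ t₀),
          ← Finset.add_sum_erase Finset.univ (fun t => sgn (u a t) * y t) (Finset.mem_univ t₀)]
        have : ∀ t ∈ Finset.univ.erase t₀, sgn (u a t) * Function.update y t₀ c t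
            = sgn (u a t) * y t := by
          intro t h
          rw [Function.update_of_ne (Finset.ne_of_mem_erase h)]
        rw [Finset.sum_congr rfl this, Function.update_self, hyt]
        ring
      have hf : ∀ c, f c = ∑ a, (∑ t, sgn (u a t) * y t - w a) ^ 2
          + 2 * (c - z t₀) * (∑ a, sgn (u a t₀) * (∑ t, sgn (u a t) * y t - w a))
          + Fintype.card A * (c - z t₀) ^ 2 := by
        intro c
        have : (Fintype.card A : ℝ) * (c - z t₀) ^ 2 = ∑ _a : A, (c - z t₀) ^ 2 := by simp
        simp only [f, hupd]
        rw [this, Finset.mul_sum, ← Finset.sum_add_distrib, ← Finset.sum_add_distrib]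
        refine Finset.sum_congr rfl fun a _ => ?_
        linear_combination (c - z t₀) ^ 2 * sgn_sq (u a t₀)
      have hle := abs_le.mp (hz t₀)
      have hcard : (0 : ℝ) ≤ Fintype.card A := Nat.cast_nonneg _
      -- Weighting `f 1` and `f (-1)` by `(1 ± z t₀)/2` cancels the linear term of `f` and leaves a
      -- mean increase of `card A * (1 - z t₀ ^ 2)`, so one of the two signs is good.
      obtain ⟨b, hb⟩ : ∃ b : Bool, f (sgn b) ≤ ∑ a, (∑ t, sgn (u a t) * y t - w a) ^ 2
          + Fintype.card A := by
        by_contra! hcon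
        have h1 := hcon true
        have h2 := hcon false
        rw [hf] at h1 h2
        simp only [sgn, if_true, Bool.false_eq_true, if_false] at h1 h2
        set B := ∑ a, sgn (u a t₀) * (∑ t, sgn (u a t) * y t - w a)
        have h3 : (0 : ℝ) ≤ Fintype.card A * z t₀ ^ 2 := by positivity
        by_cases hp : z t₀ = 1
        · rw [hp] at h1
          nlinarith
        have hlt : z t₀ < 1 := lt_of_le_of_ne hle.2 hp
        have h4 : 0 < (1 - z t₀) := by linarith
        nlinarith [mul_le_mul_of_nonneg_left h1.le (by linarith : 0 ≤ 1 + z t₀),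
          mul_lt_mul_of_pos_left h2 h4]
      refine ⟨Function.update y t₀ (sgn b), fun t h => ?_, fun t h => ?_, ?_⟩
      · by_cases htt : t = t₀
        · subst htt
          exact ⟨b, by simp⟩
        · rw [Function.update_of_ne htt]
          exact hy1 t (Finset.mem_of_mem_insert_of_ne h htt)
      · rw [Finset.mem_insert, not_or] at h
        rw [Function.update_of_ne h.1, hy2 t h.2]
      · rw [Finset.card_insert_of_notMem ht]
        push_cast
        change f (sgn b) ≤ _
        linarith
  obtain ⟨y, h1, -, h3⟩ := key Finset.univ
  choose v hv using fun t => h1 t (Finset.mem_univ t)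
  refine ⟨v, ?_⟩
  simpa only [hv, Finset.card_univ] using h3

/-! ### Moments of signed sums of levels -/

/-- The `k` equally spaced levels, symmetric about `0`. -/
def level {k : ℕ} (j : Fin k) : ℝ := 2 * (j : ℝ) - ((k : ℝ) - 1)

lemma level_rev {k : ℕ} (j : Fin k) : level j.rev = -level j := by
  have := j.isLt
  rw [level, level, Fin.val_rev, Nat.cast_sub (by omega)]
  push_cast
  ring

lemma abs_level_le {k : ℕ} (j : Fin k) : |level j| ≤ k := by
  have h : ((j : ℕ) : ℝ) + 1 ≤ k := by exact_mod_cast j.isLt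
  have h0 : (0 : ℝ) ≤ (j : ℕ) := Nat.cast_nonneg _
  rw [level, abs_le]
  constructor <;> linarith

/-- By symmetry of the levels, `exp` may be replaced by `cosh`, which gives a subgaussian bound. -/
lemma sum_exp_level_le (k : ℕ) (c : ℝ) :
    ∑ j : Fin k, Real.exp (c * level j) ≤ k * Real.exp (c ^ 2 * k ^ 2 / 2) := by
  have h1 : ∑ j : Fin k, Real.exp (c * level j) = ∑ j : Fin k, Real.exp (-(c * level j)) := by
    rw [← Equiv.sum_comp Fin.revPerm]
    refine Finset.sum_congr rfl fun j _ => ?_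
    rw [Fin.revPerm_apply, level_rev]
    ring_nf
  have h2 : ∑ j : Fin k, Real.exp (c * level j) = ∑ j : Fin k, Real.cosh (c * level j) := by
    simp only [Real.cosh_eq]
    rw [← Finset.sum_div, Finset.sum_add_distrib, ← h1]
    ring
  rw [h2]
  calc ∑ j : Fin k, Real.cosh (c * level j)
      ≤ ∑ _j : Fin k, Real.exp (c ^ 2 * k ^ 2 / 2) := by
        refine Finset.sum_le_sum fun j _ => (Real.cosh_le_exp_half_sq _).trans ?_
        rw [mul_pow]
        have : level j ^ 2 ≤ (k : ℝ) ^ 2 := sq_le_sq' (abs_le.mp (abs_level_le j)).1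
          (abs_le.mp (abs_level_le j)).2
        gcongr
    _ = _ := by simp

lemma sum_exp_linear_le (k γ : ℕ) (c : Fin γ → ℝ) :
    ∑ x : Fin γ → Fin k, Real.exp (∑ a, c a * level (x a)) ≤
      (k : ℝ) ^ γ * Real.exp (∑ a, c a ^ 2 * k ^ 2 / 2) := by
  simp only [Real.exp_sum]
  rw [← Fintype.piFinset_univ,
    ← Finset.prod_univ_sum (fun _ => Finset.univ) (fun a (j : Fin k) => Real.exp (c a * level j))]
  calc ∏ a, ∑ j : Fin k, Real.exp (c a * level j)
      ≤ ∏ a : Fin γ, ((k : ℝ) * Real.exp (c a ^ 2 * k ^ 2 / 2)) :=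
        Finset.prod_le_prod (fun _ _ => Finset.sum_nonneg fun _ _ => (Real.exp_pos _).le)
          (fun a _ => sum_exp_level_le k (c a))
    _ = _ := by rw [Finset.prod_mul_distrib]; simp

lemma pow_four_le_exp (z : ℝ) : z ^ 4 ≤ 24 * (Real.exp z + Real.exp (-z)) := by
  have h : ∀ x : ℝ, 0 ≤ x → x ^ 4 ≤ 24 * Real.exp x := by
    intro x hx
    have h1 := Real.pow_div_factorial_le_exp x hx 4
    norm_num [Nat.factorial] at h1
    linarith
  rcases le_total 0 z with hz | hz
  · have := h z hz
    have := Real.exp_pos (-z)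
    linarith
  · have h1 := h (-z) (by linarith)
    have := Real.exp_pos z
    have h2 : (-z) ^ 4 = z ^ 4 := by ring
    linarith

/-- Fourth moment of a signed sum of independent uniform levels. -/
lemma sum_pow_four_le (k γ : ℕ) (θ Λ : ℝ) (hΛ0 : 0 < Λ) (hΛ : Λ ^ 2 * (γ * θ ^ 2 * k ^ 2) ≤ 1)
    (u : Fin γ → Bool) :
    ∑ x : Fin γ → Fin k, (θ * ∑ a, sgn (u a) * level (x a)) ^ 4 ≤ (k : ℝ) ^ γ * (96 / Λ ^ 4) := by
  have hexp : Real.exp (1 / 2) ≤ 2 := by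
    have h1 := Real.exp_one_lt_d9
    have h2 : Real.exp (1 / 2) ^ 2 = Real.exp 1 := by
      rw [← Real.exp_nat_mul]; norm_num
    nlinarith [Real.exp_pos (1 / 2)]
  -- The cases `s = ±1` supply the two exponentials that dominate the fourth power; `hΛ` keeps the
  -- exponent at most `1/2`. The final constant is `96 = 24 * (2 + 2)`.
  have hc : ∀ s : ℝ, s ^ 2 = 1 →
      ∑ x : Fin γ → Fin k, Real.exp (s * (Λ * (θ * ∑ a, sgn (u a) * level (x a)))) ≤
        (k : ℝ) ^ γ * 2 := by
    intro s hs
    have h := sum_exp_linear_le k γ (fun a => s * Λ * θ * sgn (u a))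
    have e1 : ∀ x : Fin γ → Fin k, s * (Λ * (θ * ∑ a, sgn (u a) * level (x a)))
        = ∑ a, s * Λ * θ * sgn (u a) * level (x a) := by
      intro x
      simp only [Finset.mul_sum]
      exact Finset.sum_congr rfl fun a _ => by ring
    simp only [e1]
    refine h.trans ?_
    gcongr
    refine le_trans (Real.exp_le_exp.mpr ?_) hexp
    simp only [mul_pow, hs, sgn_sq]
    simp
    nlinarith
  have h1 := hc 1 (by norm_num)
  have h2 := hc (-1) (by norm_num)
  simp only [one_mul, neg_mul] at h1 h2
  have h3 : ∑ x : Fin γ → Fin k, (θ * ∑ a, sgn (u a) * level (x a)) ^ 4 * Λ ^ 4 ≤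
      24 * ((k : ℝ) ^ γ * 2 + (k : ℝ) ^ γ * 2) := by
    refine le_trans ?_ (mul_le_mul_of_nonneg_left (add_le_add h1 h2) (by norm_num))
    rw [← Finset.sum_add_distrib, Finset.mul_sum]
    refine Finset.sum_le_sum fun x _ => ?_
    rw [← mul_pow, mul_comm _ Λ]
    exact pow_four_le_exp _
  rw [← Finset.sum_mul] at h3
  rw [mul_div_assoc', le_div_iff₀ (by positivity)]
  linarith

/-! ### The code -/

/-- Most words over `k` levels are represented, up to a few letters, by the inner products of a
sign vector with orthogonal rows. -/
lemma exists_code {γ T k : ℕ} (hγ : 0 < γ) (hT : 0 < T) (u : Fin γ → Fin T → Bool)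
    (horth : ∀ a a', ∑ t, sgn (u a t) * sgn (u a' t) = if a = a' then (T : ℝ) else 0)
    (hbessel : ∀ z : Fin T → ℝ, ∑ a, (∑ t, sgn (u a t) * z t) ^ 2 ≤ T * ∑ t, z t ^ 2)
    {θ Λ η : ℝ} (hθ : 0 < θ) (hΛ0 : 0 < Λ) (hΛ : Λ ^ 2 * (γ * θ ^ 2 * k ^ 2) ≤ 1)
    (hη : 4 / (θ ^ 2 * T) + 24 / (θ ^ 2 * γ * Λ ^ 4) ≤ η / 2) :
    ∃ (G : Finset (Fin γ → Fin k)) (v : (Fin γ → Fin k) → Fin T → Bool),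
      k ^ γ ≤ 2 * G.card ∧ ∀ x ∈ G,
        ((Finset.univ.filter fun a =>
          θ * T / 2 ≤ |∑ t, sgn (u a t) * sgn (v x t) - θ * T * level (x a)|).card : ℝ)
          ≤ η * γ := by
  have hγ' : (0 : ℝ) < γ := by exact_mod_cast hγ
  have hT' : (0 : ℝ) < T := by exact_mod_cast hT
  -- By orthogonality `y x` has the exact inner products `θ * T * level (x a)`; `z x` is its
  -- clipping to the cube.
  let y : (Fin γ → Fin k) → Fin T → ℝ := fun x t => θ * ∑ a, sgn (u a t) * level (x a)
  let z : (Fin γ → Fin k) → Fin T → ℝ := fun x t => max (-1) (min 1 (y x t))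
  have hz : ∀ x t, |z x t| ≤ 1 := fun x t =>
    abs_le.mpr ⟨le_max_left _ _, max_le (by norm_num) (min_le_left _ _)⟩
  have hzy : ∀ x t, (z x t - y x t) ^ 2 ≤ y x t ^ 4 / 16 := by
    intro x t
    -- Clipping moves `y` by `max 0 (|y| - 1)`, and `|y| - 1 ≤ y ^ 2 / 4` because `(|y| - 2) ^ 2 ≥
    -- 0`.
    have h : |z x t - y x t| ≤ y x t ^ 2 / 4 := by
      simp only [z]
      rw [abs_le]
      rcases le_total 1 (y x t) with h | h
      · rw [min_eq_left h, max_eq_right (by norm_num)]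
        constructor <;> nlinarith [sq_nonneg (y x t - 2)]
      · rw [min_eq_right h]
        rcases le_total (-1) (y x t) with h' | h'
        · rw [max_eq_right h']
          constructor <;> nlinarith [sq_nonneg (y x t)]
        · rw [max_eq_left h']
          constructor <;> nlinarith [sq_nonneg (y x t + 2)]
    have := sq_le_sq' (by linarith [(abs_le.mp h).1]) (abs_le.mp h).2
    nlinarith
  have huy : ∀ x a, ∑ t, sgn (u a t) * y x t = θ * T * level (x a) := by
    intro x a
    calc ∑ t, sgn (u a t) * y x t
        = ∑ t, ∑ a', θ * level (x a') * (sgn (u a t) * sgn (u a' t)) := by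
          refine Finset.sum_congr rfl fun t _ => ?_
          simp only [y, Finset.mul_sum]
          exact Finset.sum_congr rfl fun a' _ => by ring
      _ = ∑ a', θ * level (x a') * ∑ t, sgn (u a t) * sgn (u a' t) := by
          rw [Finset.sum_comm]
          simp only [Finset.mul_sum]
      _ = _ := by
          simp only [horth]
          simp
          ring
  choose v hv using fun x => exists_rounding u (fun a => θ * T * level (x a)) (z x) (hz x)
  let E : (Fin γ → Fin k) → ℝ := fun x =>
    ∑ a, (∑ t, sgn (u a t) * sgn (v x t) - θ * T * level (x a)) ^ 2
  have hE : ∀ x, E x ≤ T * ∑ t, y x t ^ 4 / 16 + γ * T := by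
    intro x
    refine (hv x).trans ?_
    simp only [Fintype.card_fin]
    gcongr
    have : ∀ a, ∑ t, sgn (u a t) * z x t - θ * T * level (x a)
        = ∑ t, sgn (u a t) * (z x t - y x t) := by
      intro a
      simp only [mul_sub, Finset.sum_sub_distrib, huy]
    simp only [this]
    refine (hbessel _).trans ?_
    gcongr with t
    exact hzy x t
  -- `S` bounds the mean of `E`: rounding costs `γ * T`, and clipping costs the fourth moment term,
  -- with `6 = 96 / 16`. By Markov, at most half of the words have `E x > 2 * S`.
  set S : ℝ := γ * T + T ^ 2 * (6 / Λ ^ 4) with hS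
  have hSpos : 0 < S := by positivity
  have hsum : ∑ x, E x ≤ (k : ℝ) ^ γ * S := by
    calc ∑ x, E x ≤ ∑ x, ((T : ℝ) * ∑ t, y x t ^ 4 / 16 + (γ * T : ℝ)) := Finset.sum_le_sum fun x _ => hE x
      _ = (T : ℝ) / 16 * (∑ t, ∑ x, y x t ^ 4) + (k : ℝ) ^ γ * (γ * T) := by
          rw [Finset.sum_add_distrib, ← Finset.mul_sum, Finset.sum_comm]
          simp only [← Finset.sum_div]
          simp
          ring
      _ ≤ (T : ℝ) / 16 * (∑ _t : Fin T, (k : ℝ) ^ γ * (96 / Λ ^ 4)) + (k : ℝ) ^ γ * (γ * T) := by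
          gcongr with t
          exact sum_pow_four_le k γ θ Λ hΛ0 hΛ fun a => u a t
      _ = _ := by
          simp [hS]
          ring
  refine ⟨Finset.univ.filter fun x => E x ≤ 2 * S, v, ?_, ?_⟩
  · have hsplit := Finset.card_filter_add_card_filter_not
      (s := (Finset.univ : Finset (Fin γ → Fin k))) (fun x => E x ≤ 2 * S)
    rw [Finset.card_univ, Fintype.card_fun, Fintype.card_fin, Fintype.card_fin] at hsplit
    have hbad : ((Finset.univ.filter fun x => ¬ E x ≤ 2 * S).card : ℝ) * (2 * S)
        ≤ (k : ℝ) ^ γ * S := by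
      refine le_trans ?_ hsum
      rw [← nsmul_eq_mul]
      refine (Finset.card_nsmul_le_sum _ _ _ fun x hx => ?_).trans
        (Finset.sum_le_sum_of_subset_of_nonneg (Finset.filter_subset _ _)
          fun x _ _ => Finset.sum_nonneg fun _ _ => sq_nonneg _)
      exact (not_le.mp (Finset.mem_filter.mp hx).2).le
    have h2 : 2 * ((Finset.univ.filter fun x => ¬ E x ≤ 2 * S).card : ℝ) ≤ (k : ℝ) ^ γ := by
      have : (2 * ((Finset.univ.filter fun x => ¬ E x ≤ 2 * S).card : ℝ)) * S
          ≤ (k : ℝ) ^ γ * S := by linarith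
      exact le_of_mul_le_mul_right this hSpos
    have h3 : 2 * (Finset.univ.filter fun x => ¬ E x ≤ 2 * S).card ≤ k ^ γ := by exact_mod_cast h2
    omega
  · intro x hx
    have hx' : E x ≤ 2 * S := (Finset.mem_filter.mp hx).2
    set F := Finset.univ.filter fun a =>
          θ * T / 2 ≤ |∑ t, sgn (u a t) * sgn (v x t) - θ * T * level (x a)| with hF
    -- Each miscoded letter contributes at least `(θ * T / 2) ^ 2` to `E x`.
    have h1 : (F.card : ℝ) * (θ * T / 2) ^ 2 ≤ E x := by
      rw [← nsmul_eq_mul]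
      refine (Finset.card_nsmul_le_sum F _ _ fun a ha => ?_).trans
        (Finset.sum_le_sum_of_subset_of_nonneg (Finset.subset_univ F) fun _ _ _ => sq_nonneg _)
      rw [← sq_abs (∑ t, _ - _)]
      have := (Finset.mem_filter.mp ha).2
      gcongr
    have h2 : 2 * S = (θ * T / 2) ^ 2 *
        (2 * γ * (4 / (θ ^ 2 * T) + 24 / (θ ^ 2 * γ * Λ ^ 4))) := by
      rw [hS]
      field_simp
      ring
    have h3 : (θ * T / 2) ^ 2 * (F.card : ℝ) ≤ (θ * T / 2) ^ 2 *
        (2 * γ * (4 / (θ ^ 2 * T) + 24 / (θ ^ 2 * γ * Λ ^ 4))) := by linarith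
    have h4 := le_of_mul_le_mul_left h3 (by positivity)
    nlinarith


/-! ### Votes that store bits and votes that query a pair -/

/-- A vote that ranks the candidates by increasing key (ties broken somehow). -/
def voteOfKey {n : ℕ} (key : Fin n → ℕ) : Vote n := (Tuple.sort key)⁻¹

lemma ahead_voteOfKey {n : ℕ} {key : Fin n → ℕ} {i j : Fin n} (h : key i < key j) :
    Ahead (voteOfKey key) i j := by
  by_contra hcon
  have h1 : voteOfKey key j ≤ voteOfKey key i := not_lt.mp hcon
  have h2 := Tuple.monotone_sort key h1
  simp [voteOfKey] at h2
  omega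

lemma not_ahead_of_ahead {n : ℕ} {v : Vote n} {i j : Fin n} (h : Ahead v i j) : ¬ Ahead v j i :=
  not_lt.mpr (le_of_lt h)

lemma pairwiseCount_append {n : ℕ} (σ τ : List (Vote n)) (i j : Fin n) :
    pairwiseCount (σ ++ τ) i j = pairwiseCount σ i j + pairwiseCount τ i j :=
  List.countP_append

lemma pairwiseCount_le_length {n : ℕ} (σ : List (Vote n)) (i j : Fin n) :
    pairwiseCount σ i j ≤ σ.length := List.countP_le_length

lemma pairwiseCount_replicate_of_ahead {n : ℕ} {v : Vote n} {i j : Fin n} (h : Ahead v i j)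
    (l : ℕ) : pairwiseCount (List.replicate l v) i j = l := by
  simp [pairwiseCount, List.countP_replicate, h]

lemma pairwiseCount_replicate_of_not_ahead {n : ℕ} {v : Vote n} {i j : Fin n}
    (h : ¬ Ahead v i j) (l : ℕ) : pairwiseCount (List.replicate l v) i j = 0 := by
  simp [pairwiseCount, List.countP_replicate, h]

section Gadget

variable {γ M n : ℕ} (e : Fin γ ⊕ Fin M ≃ Fin n)

/-- The vote with, from the top: the right candidates with bit `1`, the left candidates with bit
`1`, the right candidates with bit `0`, the left candidates with bit `0`. -/
def bitVote (P : Fin γ → Bool) (R : Fin M → Bool) : Vote n :=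
  voteOfKey fun i => Sum.elim (fun a => if P a then 1 else 3) (fun b => if R b then 0 else 2)
    (e.symm i)

lemma ahead_bitVote_iff (P : Fin γ → Bool) (R : Fin M → Bool) (a : Fin γ) (b : Fin M) :
    Ahead (bitVote e P R) (e (Sum.inl a)) (e (Sum.inr b)) ↔ P a = true ∧ R b = false := by
  constructor
  · intro h
    by_contra hcon
    refine not_ahead_of_ahead h (ahead_voteOfKey ?_)
    cases hP : P a <;> cases hR : R b <;> simp_all
  · rintro ⟨h1, h2⟩
    exact ahead_voteOfKey (by simp [h1, h2])

/-- The votes that encode `T` columns of bits, each followed by its complement. -/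
def columnVotes {T : ℕ} (u : Fin γ → Fin T → Bool) (v : Fin M → Fin T → Bool) :
    List (Vote n) :=
  (List.finRange T).flatMap fun t =>
    [bitVote e (fun a => u a t) (fun b => v b t), bitVote e (fun a => !u a t) (fun b => !v b t)]

lemma length_columnVotes {T : ℕ} (u : Fin γ → Fin T → Bool) (v : Fin M → Fin T → Bool) :
    (columnVotes e u v).length = 2 * T := by
  simp [columnVotes, mul_comm]

/-- The bit pair `(1,0)` is counted by the vote and `(0,1)` by its complement, so the count is a
Hamming distance. -/
lemma pairwiseCount_columnVotes {T : ℕ} (u : Fin γ → Fin T → Bool) (v : Fin M → Fin T → Bool)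
    (a : Fin γ) (b : Fin M) :
    pairwiseCount (columnVotes e u v) (e (Sum.inl a)) (e (Sum.inr b)) =
      (Finset.univ.filter fun t => u a t ≠ v b t).card := by
  have h : ∀ t : Fin T, pairwiseCount
      [bitVote e (fun a => u a t) (fun b => v b t), bitVote e (fun a => !u a t) (fun b => !v b t)]
      (e (Sum.inl a)) (e (Sum.inr b)) = if u a t ≠ v b t then 1 else 0 := by
    intro t
    simp only [pairwiseCount, List.countP_cons, List.countP_nil, ahead_bitVote_iff]
    cases u a t <;> cases v b t <;> simp
  rw [Finset.card_filter, columnVotes, pairwiseCount, List.countP_flatMap, Fin.sum_univ_def]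
  congr 1
  exact List.map_congr_left fun t _ => h t

/-- The first part of the stream: the column votes, repeated. -/
def dataVotes {T : ℕ} (rep : ℕ) (u : Fin γ → Fin T → Bool) (v : Fin M → Fin T → Bool) :
    List (Vote n) :=
  (List.replicate rep (columnVotes e u v)).flatten

lemma length_dataVotes {T : ℕ} (rep : ℕ) (u : Fin γ → Fin T → Bool) (v : Fin M → Fin T → Bool) :
    (dataVotes e rep u v).length = rep * (2 * T) := by
  simp [dataVotes, length_columnVotes]

lemma pairwiseCount_dataVotes {T : ℕ} (rep : ℕ) (u : Fin γ → Fin T → Bool)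
    (v : Fin M → Fin T → Bool) (a : Fin γ) (b : Fin M) :
    pairwiseCount (dataVotes e rep u v) (e (Sum.inl a)) (e (Sum.inr b)) =
      rep * (Finset.univ.filter fun t => u a t ≠ v b t).card := by
  rw [← pairwiseCount_columnVotes e]
  simp [pairwiseCount, dataVotes, List.countP_flatten]

end Gadget

/-- A vote with `i` on top and `j` second. -/
def topVote {n : ℕ} (i j : Fin n) : Vote n :=
  voteOfKey fun l => if l = i then 0 else if l = j then 1 else 2

lemma ahead_topVote_fst {n : ℕ} {i j l : Fin n} (h : l ≠ i) : Ahead (topVote i j) i l :=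
  ahead_voteOfKey (by by_cases l = j <;> simp_all)

lemma ahead_topVote_snd {n : ℕ} {i j l : Fin n} (hij : j ≠ i) (h : l ≠ i) (h' : l ≠ j) :
    Ahead (topVote i j) j l :=
  ahead_voteOfKey (by simp_all)

/-- The second part of the stream, which singles out the comparison of `i` and `j`. -/
def queryVotes {n : ℕ} (l₁ l₂ : ℕ) (i j : Fin n) : List (Vote n) :=
  List.replicate l₁ (topVote i j) ++ List.replicate l₂ (topVote j i)

lemma length_queryVotes {n : ℕ} (l₁ l₂ : ℕ) (i j : Fin n) :
    (queryVotes l₁ l₂ i j).length = l₁ + l₂ := by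
  simp [queryVotes]

lemma maximinScore_le {n : ℕ} (σ : List (Vote n)) {i j : Fin n} (h : j ≠ i) :
    maximinScore σ i ≤ pairwiseCount σ i j :=
  ciInf_le (OrderBot.bddBelow _) (⟨j, h⟩ : {j : Fin n // j ≠ i})

/-- Any `l ≠ i` loses to `i` in all `l₁` votes with `i` on top, so it scores at most `σ.length + l₂
≤ l₁`. Candidate `i` itself is limited only by `j`: against any other candidate it wins all `l₁ +
l₂` query votes, and `h₂` makes this enough. -/
lemma maxMaximinScore_append_queryVotes {n : ℕ} (σ : List (Vote n)) {l₁ l₂ : ℕ} {i j : Fin n}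
    (hij : j ≠ i) (h₁ : σ.length + l₂ ≤ l₁) (h₂ : pairwiseCount σ i j ≤ l₂) :
    maxMaximinScore (σ ++ queryVotes l₁ l₂ i j) = l₁ + pairwiseCount σ i j := by
  have hcij : pairwiseCount (σ ++ queryVotes l₁ l₂ i j) i j = l₁ + pairwiseCount σ i j := by
    rw [pairwiseCount_append, queryVotes, pairwiseCount_append,
      pairwiseCount_replicate_of_ahead (ahead_topVote_fst hij),
      pairwiseCount_replicate_of_not_ahead (not_ahead_of_ahead (ahead_topVote_fst hij.symm))]
    ring
  apply le_antisymm
  · refine Finset.sup_le fun l _ => ?_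
    by_cases hl : l = i
    · subst hl
      exact (maximinScore_le _ hij).trans hcij.le
    · refine (maximinScore_le _ (Ne.symm hl)).trans ?_
      rw [pairwiseCount_append, queryVotes, pairwiseCount_append,
        pairwiseCount_replicate_of_not_ahead (not_ahead_of_ahead (ahead_topVote_fst hl))]
      have h3 := pairwiseCount_le_length σ l i
      have h4 := pairwiseCount_le_length (List.replicate l₂ (topVote j i)) l i
      rw [List.length_replicate] at h4
      omega
  · refine le_trans ?_ (Finset.le_sup (f := fun l => maximinScore _ l) (Finset.mem_univ i))
    have : Nonempty {l : Fin n // l ≠ i} := ⟨⟨j, hij⟩⟩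
    refine le_ciInf fun ⟨l, hl⟩ => ?_
    by_cases hlj : l = j
    · subst hlj
      exact hcij.ge
    · rw [pairwiseCount_append, queryVotes, pairwiseCount_append,
        pairwiseCount_replicate_of_ahead (ahead_topVote_fst hl),
        pairwiseCount_replicate_of_ahead (ahead_topVote_snd hij.symm hlj hl)]
      omega


/-! ### Runs of an algorithm and fixing its coins -/

open MeasureTheory

section Averaging

variable {Ω : Type*} [MeasurableSpace Ω] {V : Type*} {s : ℕ}

lemma measurable_apply_of_countable {Q β : Type*} [Countable Q] [MeasurableSpace Q]
    [MeasurableSingletonClass Q] [MeasurableSpace β] {f : Ω → Q → β}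
    (hf : ∀ q, Measurable fun ω => f ω q) {g : Ω → Q} (hg : Measurable g) :
    Measurable fun ω => f ω (g ω) :=
  (measurable_from_prod_countable_left (f := Function.uncurry f) hf).comp
    (measurable_id.prodMk hg)

lemma OnePassAlg.measurable_runFrom (A : OnePassAlg Ω V s) (σ : List V) :
    ∀ (t : ℕ) (q : Ω → Memory s), Measurable q → Measurable fun ω => A.runFrom ω t (q ω) σ := by
  induction σ with
  | nil => exact fun t q hq => hq
  | cons x σ ih =>
    exact fun t q hq => ih (t + 1) (fun ω => A.step ω t (q ω) x)
      (measurable_apply_of_countable (fun q => A.measurable_step t q x) hq)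

lemma OnePassAlg.measurable_output (A : OnePassAlg Ω V s) (σ : List V) :
    Measurable fun ω => A.output ω σ :=
  measurable_apply_of_countable A.measurable_out
    (A.measurable_runFrom σ 0 A.init A.measurable_init)

lemma OnePassAlg.runFrom_append (A : OnePassAlg Ω V s) (ω : Ω) (σ τ : List V) :
    ∀ (t : ℕ) (q : Memory s),
      A.runFrom ω t q (σ ++ τ) = A.runFrom ω (t + σ.length) (A.runFrom ω t q σ) τ := by
  induction σ with
  | nil => exact fun t q => rfl
  | cons x σ ih =>
    intro t q
    rw [List.cons_append, runFrom, ih, runFrom, List.length_cons]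
    congr 1
    ring

/-- If each of finitely many events has probability at least `p`, then some outcome lies in at
least a fraction `p` of them. -/
lemma exists_mem_many {I : Type*} (S : Finset I) (μ : Measure Ω) [IsProbabilityMeasure μ]
    (E : I → Set Ω) (hE : ∀ i, MeasurableSet (E i)) {p : ℝ} (hp : ∀ i ∈ S, p ≤ μ.real (E i)) :
    ∃ ω, p * S.card ≤ ∑ i ∈ S, (E i).indicator (fun _ => (1 : ℝ)) ω := by
  have hint : ∀ i ∈ S, Integrable ((E i).indicator fun _ => (1 : ℝ)) μ :=
    fun i _ => (integrable_const 1).indicator (hE i)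
  obtain ⟨ω, hω⟩ := exists_integral_le (integrable_finsetSum S hint)
  refine ⟨ω, le_trans ?_ hω⟩
  rw [integral_finsetSum S hint, mul_comm, ← nsmul_eq_mul]
  refine Finset.card_nsmul_le_sum _ _ _ fun i hi => ?_
  rw [integral_indicator_const _ (hE i)]
  simpa using hp i hi

end Averaging

/-! ### Counting words close to a guess -/

/-- The number of coordinates in which two families of words agree. -/
def agreement {M γ k : ℕ} (g x : Fin M → Fin γ → Fin k) : ℕ :=
  (Finset.univ.filter fun i : Fin M × Fin γ => g i.1 i.2 = x i.1 i.2).card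

/-- The weight factors over coordinates, and each factor sums to `k + (k - 1) ≤ 2 * k`. An
exponential moment of this kind makes large agreement rare. -/
lemma sum_pow_agreement_le {M γ k : ℕ} (g : Fin M → Fin γ → Fin k) :
    ∑ x : Fin M → Fin γ → Fin k, k ^ agreement g x ≤ (2 * k) ^ (M * γ) := by
  calc ∑ x : Fin M → Fin γ → Fin k, k ^ agreement g x
      = ∑ x : Fin M × Fin γ → Fin k, ∏ i, if g i.1 i.2 = x i then k else 1 := by
        rw [← (Equiv.curry (Fin M) (Fin γ) (Fin k)).sum_comp]
        refine Finset.sum_congr rfl fun x _ => ?_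
        rw [Finset.prod_ite]
        simp [agreement]
    _ = ∏ i : Fin M × Fin γ, ∑ j : Fin k, if g i.1 i.2 = j then k else 1 := by
        rw [Finset.prod_univ_sum (fun _ => Finset.univ)
          (fun (i : Fin M × Fin γ) (j : Fin k) => if g i.1 i.2 = j then k else 1),
          Fintype.piFinset_univ]
    _ ≤ ∏ _i : Fin M × Fin γ, 2 * k := by
        refine Finset.prod_le_prod' fun i _ => ?_
        calc ∑ j : Fin k, (if g i.1 i.2 = j then k else 1)
            ≤ ∑ j : Fin k, ((if g i.1 i.2 = j then k else 0) + 1) :=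
              Finset.sum_le_sum fun j _ => by split_ifs <;> omega
          _ = 2 * k := by
              rw [Finset.sum_add_distrib]
              simp
              ring
    _ = _ := by simp

/-- A memory that determines many coordinates of the average word of a large product code over a
large alphabet has many states. -/
lemma le_card_of_agreement {M γ κ : ℕ} (hM : 0 < M) (hγ : 0 < γ) {Q : Type*} [Fintype Q]
    (G : Finset (Fin γ → Fin (2 ^ κ))) (hG : (2 ^ κ) ^ γ ≤ 2 * G.card)
    (mem : (Fin M → Fin γ → Fin (2 ^ κ)) → Q) (guess : Q → Fin M → Fin γ → Fin (2 ^ κ))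
    {p : ℝ} (hκ : 16 ≤ κ * p)
    (h : 3 * p / 4 * ((G.card : ℝ) ^ M * (M * γ)) ≤
      ∑ x ∈ Fintype.piFinset fun _ => G, (agreement (guess (mem x)) x : ℝ)) :
    p / 2 * 2 ^ (2 * (M * γ)) ≤ Fintype.card Q := by
  have hN : (0 : ℝ) < M * γ := by positivity
  have hGpos : 0 < G.card := by
    have : 0 < (2 ^ κ) ^ γ := by positivity
    omega
  set C : ℝ := (G.card : ℝ) ^ M with hC
  have hCpos : 0 < C := by positivity
  have hcard : ((Fintype.piFinset fun _ : Fin M => G).card : ℝ) = C := by simp [hC]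
  set W := (Fintype.piFinset fun _ : Fin M => G).filter
    fun x => p / 4 * (M * γ) ≤ (agreement (guess (mem x)) x : ℝ) with hW
  have hagr : ∀ g x : Fin M → Fin γ → Fin (2 ^ κ), (agreement g x : ℝ) ≤ M * γ := by
    intro g x
    have : agreement g x ≤ M * γ := (Finset.card_le_univ _).trans (by simp)
    exact_mod_cast this
  -- Reverse Markov: words outside `W` contribute at most `p / 4` to the mean agreement fraction `3
  -- * p / 4`.
  have hWcard : p / 2 * C ≤ W.card := by
    have h1 : ∑ x ∈ Fintype.piFinset fun _ : Fin M => G, (agreement (guess (mem x)) x : ℝ) ≤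
        ∑ x ∈ Fintype.piFinset fun _ : Fin M => G,
          ((if p / 4 * (M * γ) ≤ (agreement (guess (mem x)) x : ℝ) then (M * γ : ℝ) else 0)
            + p / 4 * (M * γ)) := by
      have hp : 0 ≤ p := by
        by_contra hcon
        have : (κ : ℝ) * p ≤ 0 :=
          mul_nonpos_of_nonneg_of_nonpos (Nat.cast_nonneg _) (not_le.mp hcon).le
        linarith
      refine Finset.sum_le_sum fun x _ => ?_
      have := hagr (guess (mem x)) x
      split_ifs with hif
      · have : 0 ≤ p / 4 * (M * γ : ℝ) := by positivity
        linarith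
      · linarith
    rw [Finset.sum_add_distrib, ← Finset.sum_filter, Finset.sum_const, Finset.sum_const,
      nsmul_eq_mul, nsmul_eq_mul, hcard] at h1
    have h2 : p / 2 * C * (M * γ) ≤ W.card * (M * γ : ℝ) := by
      have := h.trans h1
      linarith
    exact le_of_mul_le_mul_right h2 hN
  -- Since `κ * p / 4 ≥ 4`, each word of `W` has weight at least `2 ^ (4 * (M * γ))` for the guess
  -- of its own memory state; the weights are then summed over all states.
  have hcount : W.card * 2 ^ (4 * (M * γ)) ≤ Fintype.card Q * (2 * 2 ^ κ) ^ (M * γ) := by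
    calc W.card * 2 ^ (4 * (M * γ))
        ≤ ∑ x ∈ W, (2 ^ κ) ^ agreement (guess (mem x)) x := by
          rw [← smul_eq_mul]
          refine Finset.card_nsmul_le_sum _ _ _ fun x hx => ?_
          rw [← pow_mul]
          refine Nat.pow_le_pow_right (by norm_num) ?_
          have h1 := (Finset.mem_filter.mp hx).2
          have h2 : (4 * (M * γ) : ℝ) ≤ κ * agreement (guess (mem x)) x := by
            calc (4 * (M * γ) : ℝ) ≤ κ * p / 4 * (M * γ) := by
                  have := mul_le_mul_of_nonneg_right hκ hN.le
                  linarith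
              _ = κ * (p / 4 * (M * γ)) := by ring
              _ ≤ _ := by gcongr
          exact_mod_cast h2
      _ ≤ ∑ x, ∑ q, (2 ^ κ) ^ agreement (guess q) x := by
          refine (Finset.sum_le_sum_of_subset (Finset.subset_univ W)).trans ?_
          exact Finset.sum_le_sum fun x _ => Finset.single_le_sum
            (f := fun q => (2 ^ κ) ^ agreement (guess q) x) (fun _ _ => Nat.zero_le _)
            (Finset.mem_univ (mem x))
      _ = ∑ q, ∑ x, (2 ^ κ) ^ agreement (guess q) x := Finset.sum_comm
      _ ≤ ∑ _q : Q, (2 * 2 ^ κ) ^ (M * γ) :=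
          Finset.sum_le_sum fun q _ => sum_pow_agreement_le (guess q)
      _ = _ := by simp
  have hcount' : (W.card : ℝ) * 2 ^ (4 * (M * γ)) ≤
      Fintype.card Q * (2 * 2 ^ κ) ^ (M * γ) := by exact_mod_cast hcount
  -- Keeping only half of the words in each of `M` factors costs `2 ^ M`, which is at most `2 ^ (M *
  -- γ)`.
  have hk : ((2 : ℝ) ^ κ) ^ (M * γ) ≤ 2 ^ (M * γ) * C := by
    have hG' : ((2 : ℝ) ^ κ) ^ γ ≤ 2 * G.card := by exact_mod_cast hG
    calc ((2 : ℝ) ^ κ) ^ (M * γ) = (((2 : ℝ) ^ κ) ^ γ) ^ M := by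
          rw [← pow_mul ((2 : ℝ) ^ κ), mul_comm γ]
      _ ≤ (2 * G.card) ^ M := by gcongr
      _ = 2 ^ M * C := by rw [mul_pow]
      _ ≤ _ := by
          gcongr
          · norm_num
          · exact Nat.le_mul_of_pos_right M hγ
  have hfin : p / 2 * 2 ^ (2 * (M * γ)) * (C * 2 ^ (2 * (M * γ))) ≤
      Fintype.card Q * (C * 2 ^ (2 * (M * γ))) := by
    calc p / 2 * 2 ^ (2 * (M * γ)) * (C * 2 ^ (2 * (M * γ)))
        = p / 2 * C * 2 ^ (4 * (M * γ)) := by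
          rw [show 4 * (M * γ) = 2 * (M * γ) + 2 * (M * γ) by ring, pow_add]
          ring
      _ ≤ W.card * 2 ^ (4 * (M * γ)) := by gcongr
      _ ≤ Fintype.card Q * (2 * 2 ^ κ) ^ (M * γ) := hcount'
      _ = Fintype.card Q * (2 ^ (M * γ) * (2 ^ κ) ^ (M * γ)) := by rw [mul_pow]
      _ ≤ Fintype.card Q * (2 ^ (M * γ) * (2 ^ (M * γ) * C)) := by gcongr
      _ = _ := by rw [two_mul (M * γ), pow_add]; ring
  exact le_of_mul_le_mul_right hfin (by positivity)

/-! ### The reduction from the code to maximin -/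

lemma sum_sgn_mul_sgn {T : ℕ} (u v : Fin T → Bool) :
    ∑ t, sgn (u t) * sgn (v t) = T - 2 * ((Finset.univ.filter fun t => u t ≠ v t).card : ℝ) := by
  rw [Finset.card_filter, Nat.cast_sum, Finset.mul_sum]
  have : (T : ℝ) = ∑ _t : Fin T, 1 := by simp
  rw [this, ← Finset.sum_sub_distrib]
  refine Finset.sum_congr rfl fun t _ => ?_
  cases u t <;> cases v t <;> norm_num [sgn]

/-- Distinct levels differ by at least `2`, so the open intervals of radius `c` around the points `c
* level j` are disjoint. -/
lemma level_unique {k : ℕ} {c z : ℝ} {i j : Fin k} (hi : |z - c * level i| < c)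
    (hj : |z - c * level j| < c) : i = j := by
  have hc : 0 < c := (abs_nonneg _).trans_lt hi
  rw [abs_lt] at hi hj
  have h1 : c * level i < c * (level j + 2) := by linarith
  have h2 : c * level j < c * (level i + 2) := by linarith
  have h3 := lt_of_mul_lt_mul_left h1 hc.le
  have h4 := lt_of_mul_lt_mul_left h2 hc.le
  simp only [level] at h3 h4
  have h5 : ((i : ℕ) : ℝ) < (j : ℕ) + 1 := by linarith
  have h6 : ((j : ℕ) : ℝ) < (i : ℕ) + 1 := by linarith
  have h7 : (i : ℕ) < j + 1 := by exact_mod_cast h5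
  have h8 : (j : ℕ) < i + 1 := by exact_mod_cast h6
  exact Fin.ext (by omega)

/-- The reduction: an algorithm for maximin yields a memory that determines many coordinates of a
word of the product code. -/
lemma le_two_pow_of_solvesMaximin {Ω : Type*} [MeasurableSpace Ω] (μ : Measure Ω)
    [IsProbabilityMeasure μ] {γ M n m s T rep κ : ℕ} (e : Fin γ ⊕ Fin M ≃ Fin n)
    (A : OnePassAlg Ω (Vote n) s) {ε δ θ : ℝ} (hA : SolvesMaximin μ A m ε δ)
    (hM : 0 < M) (hγ : 0 < γ) (hrep : 0 < rep) (hm : 6 * T * rep ≤ m)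
    (hprec : 4 * (ε * m) ≤ θ * T * rep) (u : Fin γ → Fin T → Bool)
    (G : Finset (Fin γ → Fin (2 ^ κ))) (v : (Fin γ → Fin (2 ^ κ)) → Fin T → Bool)
    (hG : (2 ^ κ) ^ γ ≤ 2 * G.card)
    (hv : ∀ x ∈ G, ((Finset.univ.filter fun a =>
          θ * T / 2 ≤ |∑ t, sgn (u a t) * sgn (v x t) - θ * T * level (x a)|).card : ℝ)
          ≤ (1 - δ) / 4 * γ)
    (hκ : 16 ≤ κ * (1 - δ)) :
    (1 - δ) / 2 * 2 ^ (2 * (M * γ)) ≤ 2 ^ s := by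
  classical
  -- The data have length `2 * T * rep` and pair counts at most `T * rep = l₂`. Then `l₁` fills the
  -- stream up to `m`, and `6 * T * rep ≤ m` yields data length plus `l₂` at most `l₁`.
  let l₂ := T * rep
  let l₁ := m - 3 * (T * rep)
  have hl : 6 * (T * rep) ≤ m := by rwa [← mul_assoc]
  have hrep' : (0 : ℝ) < rep := by exact_mod_cast hrep
  let data : (Fin M → Fin γ → Fin (2 ^ κ)) → List (Vote n) :=
    fun x => dataVotes e rep u (fun b => v (x b))
  let query : Fin M × Fin γ → List (Vote n) :=
    fun i => queryVotes l₁ l₂ (e (Sum.inl i.2)) (e (Sum.inr i.1))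
  have hlen : ∀ x, (data x).length = rep * (2 * T) := fun x => length_dataVotes e rep u _
  have hlen' : ∀ x i, (data x ++ query i).length = m := by
    intro x i
    have e1 : rep * (2 * T) = 2 * (T * rep) := by ring
    rw [List.length_append, hlen, length_queryVotes]
    simp only [l₁, l₂]
    omega
  let D : (Fin M → Fin γ → Fin (2 ^ κ)) → Fin M × Fin γ → ℕ :=
    fun x i => (Finset.univ.filter fun t => u i.2 t ≠ v (x i.1) t).card
  have hscore : ∀ x i, maxMaximinScore (data x ++ query i) = l₁ + rep * D x i := by
    intro x i
    have hc := pairwiseCount_dataVotes e rep u (fun b => v (x b)) i.2 i.1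
    have hD : D x i ≤ T := (Finset.card_le_univ _).trans (by simp)
    rw [maxMaximinScore_append_queryVotes (data x) (by simp), hc]
    · have e1 : rep * (2 * T) = 2 * (T * rep) := by ring
      rw [hlen]
      simp only [l₁, l₂]
      omega
    · rw [hc]
      simp only [l₂]
      rw [mul_comm T]
      exact Nat.mul_le_mul_left _ hD
  -- One outcome of the coins is fixed that answers a fraction `1 - δ` of all pairs of word family
  -- and query correctly.
  obtain ⟨ω, hω⟩ := exists_mem_many
    ((Fintype.piFinset fun _ : Fin M => G) ×ˢ (Finset.univ : Finset (Fin M × Fin γ))) μ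
    (fun j => {ω | |A.output ω (data j.1 ++ query j.2)
      - (maxMaximinScore (data j.1 ++ query j.2) : ℝ)| ≤ ε * (m : ℝ)})
    (fun j => measurableSet_le ((A.measurable_output _).sub_const _).abs measurable_const)
    (fun j _ => hA _ (hlen' _ _))
  let mem : (Fin M → Fin γ → Fin (2 ^ κ)) → Memory s :=
    fun x => A.runFrom ω 0 (A.init ω) (data x)
  -- The one-pass property enters here: all data have the same length, so the run on the query
  -- depends on the data only through the memory.
  let est : Memory s → Fin M × Fin γ → ℝ := fun q i =>
    T - 2 * ((A.out ω (A.runFrom ω (rep * (2 * T)) q (query i)) - l₁) / rep)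
  have hest : ∀ x i, est (mem x) i =
      T - 2 * ((A.output ω (data x ++ query i) - l₁) / rep) := by
    intro x i
    rw [OnePassAlg.output, OnePassAlg.runFrom_append, hlen, zero_add]
  let guess : Memory s → Fin M → Fin γ → Fin (2 ^ κ) := fun q b a =>
    -- Letter `0` is an arbitrary default when no level fits.
    if h : ∃ j, |est q (b, a) - θ * T * level j| < θ * T then h.choose else ⟨0, by positivity⟩
  have hdec : ∀ x i,
      |A.output ω (data x ++ query i) - (maxMaximinScore (data x ++ query i) : ℝ)| ≤ ε * m →
      ¬ θ * T / 2 ≤ |∑ t, sgn (u i.2 t) * sgn (v (x i.1) t) - θ * T * level (x i.1 i.2)| →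
      guess (mem x) i.1 i.2 = x i.1 i.2 := by
    intro x i h1 h2
    -- The answer error, scaled by `2 / rep`, takes half of the radius `θ * T`; the coding error
    -- takes less than the other half.
    have h3 : |est (mem x) i - ∑ t, sgn (u i.2 t) * sgn (v (x i.1) t)| ≤ θ * T / 2 := by
      rw [sum_sgn_mul_sgn, hest]
      rw [hscore, Nat.cast_add, Nat.cast_mul] at h1
      have e1 : (T - 2 * ((A.output ω (data x ++ query i) - l₁) / rep)
          - (T - 2 * ((Finset.univ.filter fun t => u i.2 t ≠ v (x i.1) t).card : ℝ)))
          = -(2 / rep) * (A.output ω (data x ++ query i) - (l₁ + rep * D x i)) := by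
        simp only [D]
        field_simp
        ring
      rw [e1, abs_mul, abs_neg, abs_of_pos (by positivity : (0 : ℝ) < 2 / rep)]
      calc 2 / rep * |A.output ω (data x ++ query i) - (l₁ + rep * D x i)|
          ≤ 2 / rep * (ε * m) := by gcongr
        _ ≤ 2 / rep * (θ * T * rep / 4) := by
            gcongr
            linarith
        _ = θ * T / 2 := by
            field_simp
            ring
    have h4 : |est (mem x) i - θ * T * level (x i.1 i.2)| < θ * T := by
      have := abs_sub_le (est (mem x) i) (∑ t, sgn (u i.2 t) * sgn (v (x i.1) t))
        (θ * T * level (x i.1 i.2))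
      linarith [not_le.mp h2]
    have h5 : ∃ j, |est (mem x) (i.1, i.2) - θ * T * level j| < θ * T := ⟨_, h4⟩
    simp only [guess, dif_pos h5]
    exact level_unique h5.choose_spec h4
  have hkey := le_card_of_agreement (Q := Memory s) hM hγ G hG mem guess hκ ?_
  · simpa using hkey
  rw [Finset.card_product, Finset.sum_product, Finset.card_univ, Fintype.card_prod,
    Fintype.card_fin, Fintype.card_fin, Fintype.card_piFinset_const] at hω
  push_cast at hω
  -- A correct answer recovers its letter unless that letter is miscoded; this loses `(1 - δ) / 4`
  -- and leaves `3 * (1 - δ) / 4`.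
  have hx : ∀ x ∈ Fintype.piFinset fun _ : Fin M => G,
      ∑ i : Fin M × Fin γ, Set.indicator {ω | |A.output ω (data x ++ query i)
        - (maxMaximinScore (data x ++ query i) : ℝ)| ≤ ε * (m : ℝ)} (fun _ => (1 : ℝ)) ω ≤
      agreement (guess (mem x)) x + (1 - δ) / 4 * (M * γ) := by
    intro x hxG
    rw [Fintype.mem_piFinset] at hxG
    have hbad : ∑ i : Fin M × Fin γ, (if θ * T / 2 ≤
        |∑ t, sgn (u i.2 t) * sgn (v (x i.1) t) - θ * T * level (x i.1 i.2)| then (1 : ℝ) else 0)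
        ≤ (1 - δ) / 4 * (M * γ) := by
      rw [Fintype.sum_prod_type]
      calc _ ≤ ∑ _b : Fin M, (1 - δ) / 4 * γ := by
            refine Finset.sum_le_sum fun b _ => ?_
            have := hv (x b) (hxG b)
            rwa [Finset.card_filter, Nat.cast_sum, Finset.sum_congr rfl
              (fun a _ => Nat.cast_ite _ _ _), Nat.cast_one, Nat.cast_zero] at this
        _ = _ := by
            simp
            ring
    refine le_trans ?_ (add_le_add_right hbad _)
    rw [agreement, Finset.card_filter, Nat.cast_sum, ← Finset.sum_add_distrib]
    refine Finset.sum_le_sum fun i _ => ?_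
    by_cases h1 : |A.output ω (data x ++ query i)
        - (maxMaximinScore (data x ++ query i) : ℝ)| ≤ ε * m
    · rw [Set.indicator_of_mem (by exact h1)]
      by_cases h2 : θ * T / 2 ≤
        |∑ t, sgn (u i.2 t) * sgn (v (x i.1) t) - θ * T * level (x i.1 i.2)|
      · rw [if_pos h2]
        simp only [Nat.cast_ite, Nat.cast_one, Nat.cast_zero, le_add_iff_nonneg_left]
        positivity
      · rw [if_pos (hdec x i h1 h2)]
        simp [h2]
    · rw [Set.indicator_of_notMem (by exact h1)]
      positivity
  have h6 := hω.trans (Finset.sum_le_sum hx)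
  rw [Finset.sum_add_distrib, Finset.sum_const, Fintype.card_piFinset_const, nsmul_eq_mul] at h6
  push_cast at h6
  linarith


/-! ### Choice of parameters -/

/-- One of the two factors `2 ^ N` absorbs the constant `p / 2`, as `2 ^ N ≥ N ≥ 2 / p`. -/
lemma le_of_half_mul_two_pow_le {p : ℝ} (hp : 0 < p) {N s : ℕ} (hN : 2 / p ≤ N)
    (h : p / 2 * 2 ^ (2 * N) ≤ (2 : ℝ) ^ s) : N ≤ s := by
  have h1 : (N : ℝ) ≤ 2 ^ N := by exact_mod_cast Nat.lt_two_pow_self.le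
  have h2 : 1 ≤ p / 2 * 2 ^ N := by
    rw [div_le_iff₀ hp] at hN
    nlinarith
  have h3 : (2 : ℝ) ^ N ≤ 2 ^ s := by
    refine le_trans ?_ h
    rw [two_mul, pow_add, ← mul_assoc]
    exact le_mul_of_one_le_left (by positivity) h2
  exact (pow_le_pow_iff_right₀ (by norm_num)).mp h3

/-- The chosen parameters make the average number of miscoded letters small. -/
lemma error_budget {p Q Λ R ε X T g : ℝ} (hp0 : 0 < p) (hp1 : p < 1) (hQ : Q = 48 / p)
    (hR : R = Λ ^ 4) (hRpos : 0 < R) (hε : 0 < ε) (hX : X * ε ^ 2 = 1) (hXpos : 0 < X)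
    (hT : X / 12 ≤ T) (hg : X / (2 * R) ≤ g) :
    4 / ((Q * ε) ^ 2 * T) + 24 / ((Q * ε) ^ 2 * g * Λ ^ 4) ≤ p / 4 / 2 := by
  have hQpos : 0 < Q := by rw [hQ]; positivity
  have hp2 : p ^ 2 ≤ p := by nlinarith
  have h1 : 4 / ((Q * ε) ^ 2 * T) ≤ p ^ 2 / 48 := by
    have h2 : Q ^ 2 / 12 ≤ (Q * ε) ^ 2 * T := by
      calc Q ^ 2 / 12 = (Q * ε) ^ 2 * (X / 12) := by linear_combination -(Q ^ 2 / 12) * hX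
        _ ≤ _ := by gcongr
    calc _ ≤ 4 / (Q ^ 2 / 12) := by gcongr
      _ = p ^ 2 / 48 := by
          rw [hQ]
          field_simp
          norm_num
  have h2 : 24 / ((Q * ε) ^ 2 * g * Λ ^ 4) ≤ p ^ 2 / 48 := by
    have h3 : Q ^ 2 / 2 ≤ (Q * ε) ^ 2 * g * Λ ^ 4 := by
      calc Q ^ 2 / 2 = Q ^ 2 * (X * ε ^ 2) / 2 := by rw [hX, mul_one]
        _ = (Q * ε) ^ 2 * (X / (2 * R)) * R := by
            field_simp
        _ ≤ (Q * ε) ^ 2 * g * R := by gcongr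
        _ = _ := by rw [hR]
    calc _ ≤ 24 / (Q ^ 2 / 2) := by gcongr
      _ = p ^ 2 / 48 := by
          rw [hQ]
          field_simp
          norm_num
  linarith

end MaximinStream

theorem mainTheorem9 (δ : ℝ) (hδ : 0 < δ) (hδ1 : δ < 1) :
    ∃ c : ℝ, 0 < c ∧ ∃ ε₀ : ℝ, 0 < ε₀ ∧
      ∀ ε : ℝ, 0 < ε → ε ≤ ε₀ →
      ∀ n m : ℕ, 1 / ε ^ 2 ≤ (n : ℝ) → 1 / ε ^ 2 ≤ (m : ℝ) →
      ∀ (s : ℕ) (Ω : Type*) [MeasurableSpace Ω] (μ : MeasureTheory.Measure Ω)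
        [MeasureTheory.IsProbabilityMeasure μ]
        (A : MaximinStream.OnePassAlg Ω (MaximinStream.Vote n) s),
        MaximinStream.SolvesMaximin μ A m ε δ →
        c * ((n : ℝ) / ε ^ 2) ≤ (s : ℝ) := by
  obtain ⟨p, hp⟩ : ∃ p, p = 1 - δ := ⟨_, rfl⟩
  have hp0 : 0 < p := by linarith
  have hp1 : p < 1 := by linarith
  obtain ⟨κ, hκ⟩ := exists_nat_ge (16 / p)
  rw [div_le_iff₀ hp0] at hκ
  obtain ⟨K, hK⟩ : ∃ K : ℝ, K = ((2 ^ κ : ℕ) : ℝ) := ⟨_, rfl⟩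
  have hK1 : 1 ≤ K := by
    rw [hK]
    exact_mod_cast Nat.one_le_two_pow
  -- `θ` will be `Q * ε`. The value `48 / p` makes both error terms of the code at most `p ^ 2 /
  -- 48`, and `Q ≥ 48 = 4 * 12` gives the precision needed for decoding.
  obtain ⟨Q, hQ⟩ : ∃ Q, Q = 48 / p := ⟨_, rfl⟩
  have hQ48 : 48 ≤ Q := by
    rw [hQ, le_div_iff₀ hp0]
    linarith
  obtain ⟨Λ, hΛ⟩ : ∃ Λ, Λ = Q * K := ⟨_, rfl⟩
  have hΛ48 : 48 ≤ Λ := by nlinarith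
  -- With `γ ≤ X / R`, this is what the moment condition `hΛ'` requires; the choice of `Λ` makes `R
  -- = Λ ^ 4`.
  obtain ⟨R, hR⟩ : ∃ R, R = Λ ^ 2 * Q ^ 2 * K ^ 2 := ⟨_, rfl⟩
  have hR12 : 12 ≤ R := by
    have h1 : 12 ≤ Λ ^ 2 := by nlinarith
    have h2 : 1 ≤ Q ^ 2 := by nlinarith
    have h3 : 1 ≤ K ^ 2 := by nlinarith
    have h4 : 12 ≤ Λ ^ 2 * Q ^ 2 := by nlinarith
    nlinarith
  have hRpos : 0 < R := by linarith
  -- `c` comes from `M ≥ n / 2` and `γ ≥ X / (2 * R)`, where `X = 1 / ε ^ 2`. The threshold ensures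
  -- `X ≥ R + 4 / p`: `R` gives `γ ≥ 1`, and `4 / p` gives `M ≥ 2 / p`.
  refine ⟨1 / (4 * R), by positivity, 1 / Real.sqrt (R + 4 / p), by positivity, ?_⟩
  intro ε hε hεε n m hn hm s Ω _ μ _ A hA
  obtain ⟨X, hX⟩ : ∃ X, X = 1 / ε ^ 2 := ⟨_, rfl⟩
  have hXε : X * ε ^ 2 = 1 := by
    rw [hX]
    field_simp
  have hX0 : R + 4 / p ≤ X := by
    have hpos : 0 < R + 4 / p := by positivity
    rw [le_div_iff₀ (Real.sqrt_pos.mpr hpos)] at hεε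
    have h1 : (ε * Real.sqrt (R + 4 / p)) ^ 2 ≤ 1 := by
      have : 0 ≤ ε * Real.sqrt (R + 4 / p) := by positivity
      nlinarith
    rw [mul_pow, Real.sq_sqrt hpos.le] at h1
    rw [hX, le_div_iff₀ (by positivity)]
    linarith
  rw [← hX] at hn hm
  have h4p : 0 < 4 / p := by positivity
  have hXR : R ≤ X := by linarith
  have hXpos : 0 < X := by linarith
  -- Sylvester matrices need a power of two; this one satisfies `X / 12 < T ≤ X / 6`, so that `γ ≤
  -- T` and `6 * T ≤ m`.
  obtain ⟨r, hr1, hr2⟩ := exists_nat_pow_near (x := X / 6) (y := 2) (by linarith) (by norm_num)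
  obtain ⟨T, hT⟩ : ∃ T : ℕ, T = 2 ^ r := ⟨_, rfl⟩
  have hTr : (T : ℝ) = 2 ^ r := by
    rw [hT]
    push_cast
    rfl
  rw [pow_succ, ← hTr] at hr2
  rw [← hTr] at hr1
  have hTpos : 0 < T := by
    rw [hT]
    positivity
  have hTpos' : (0 : ℝ) < T := by exact_mod_cast hTpos
  have hmT : 6 * T ≤ m := by
    have : (6 * T : ℝ) ≤ m := by linarith
    exact_mod_cast this
  obtain ⟨rep, hrep⟩ : ∃ rep, rep = m / (6 * T) := ⟨_, rfl⟩
  have hrep0 : 0 < rep := by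
    rw [hrep]
    exact Nat.div_pos hmT (by positivity)
  have hrepm : 6 * T * rep ≤ m := by
    rw [hrep]
    exact Nat.mul_div_le m (6 * T)
  -- As `rep ≥ 1`, rounding down the quotient loses at most a factor of two.
  have hmrep : m ≤ 12 * (T * rep) := by
    have h1 : m < 6 * T * (rep + 1) := by
      rw [hrep]
      exact Nat.lt_mul_div_succ m (by positivity)
    nlinarith
  have hmrep' : (m : ℝ) ≤ 12 * (T * rep) := by exact_mod_cast hmrep
  obtain ⟨γ, hγ⟩ : ∃ γ, γ = ⌊X / R⌋₊ := ⟨_, rfl⟩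
  have hXR1 : 1 ≤ X / R := (one_le_div hRpos).mpr hXR
  have hγ1 : (γ : ℝ) ≤ X / R := by
    rw [hγ]
    exact Nat.floor_le (by positivity)
  have hγ0 : 0 < γ := by
    rw [hγ]
    exact Nat.floor_pos.mpr hXR1
  have hγ2 : X / (2 * R) ≤ γ := by
    have h1 : X / R < γ + 1 := by
      rw [hγ]
      exact Nat.lt_floor_add_one _
    have h2 : (1 : ℝ) ≤ γ := by exact_mod_cast hγ0
    have h3 : X / (2 * R) = X / R / 2 := by
      field_simp
    rw [h3]
    linarith
  have hγX : (γ : ℝ) ≤ X / 12 :=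
    hγ1.trans (div_le_div_of_nonneg_left hXpos.le (by norm_num) hR12)
  have hγT : γ ≤ T := by
    have : (γ : ℝ) ≤ T := by linarith
    exact_mod_cast this
  have hγn : γ ≤ n := by
    have : (γ : ℝ) ≤ n := by linarith
    exact_mod_cast this
  obtain ⟨M, hM⟩ : ∃ M, M = n - γ := ⟨_, rfl⟩
  have hMn : γ + M = n := by omega
  have hMn' : (γ : ℝ) + M = n := by exact_mod_cast hMn
  have hM2 : (n : ℝ) / 2 ≤ M := by linarith
  have hMp : 2 / p ≤ M := by
    have : 4 / p = 2 * (2 / p) := by ring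
    linarith
  have hM0 : 0 < M := by
    have : (0 : ℝ) < M := lt_of_lt_of_le (by positivity) hMp
    exact_mod_cast this
  obtain ⟨θ, hθ⟩ : ∃ θ, θ = Q * ε := ⟨_, rfl⟩
  have hQpos : 0 < Q := by linarith
  have hΛpos : 0 < Λ := by linarith
  have hθ0 : 0 < θ := by
    rw [hθ]
    positivity
  obtain ⟨u, hu1, hu2⟩ := MaximinStream.exists_orthogonal_rows r γ (hT ▸ hγT)
  rw [← hTr] at hu1 hu2
  subst hT
  have hη : 4 / (θ ^ 2 * ((2 ^ r : ℕ) : ℝ)) + 24 / (θ ^ 2 * γ * Λ ^ 4) ≤ p / 4 / 2 :=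
    hθ ▸ MaximinStream.error_budget hp0 hp1 hQ (by rw [hR, hΛ]; ring) hRpos hε hXε hXpos
      (by linarith) hγ2
  have hΛ' : Λ ^ 2 * (γ * θ ^ 2 * ((2 ^ κ : ℕ) : ℝ) ^ 2) ≤ 1 := by
    rw [← hK, hθ]
    calc Λ ^ 2 * (γ * (Q * ε) ^ 2 * K ^ 2) = γ * (R * ε ^ 2) := by
          rw [hR]
          ring
      _ ≤ X / R * (R * ε ^ 2) := by gcongr
      _ = 1 := by
          rw [← hXε]
          field_simp
  obtain ⟨G, v, hG, hv⟩ := MaximinStream.exists_code hγ0 hTpos u hu1 hu2 hθ0 hΛpos hΛ' hη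
  have hprec : 4 * (ε * m) ≤ θ * ((2 ^ r : ℕ) : ℝ) * rep := by
    have hrep' : (0 : ℝ) < rep := by exact_mod_cast hrep0
    calc 4 * (ε * m) ≤ 4 * (ε * (12 * (((2 ^ r : ℕ) : ℝ) * rep))) := by gcongr
      _ = 48 * (ε * ((2 ^ r : ℕ) : ℝ) * rep) := by ring
      _ ≤ Q * (ε * ((2 ^ r : ℕ) : ℝ) * rep) := by gcongr
      _ = _ := by rw [hθ]; ring
  rw [hp] at hκ hv
  have hmain := MaximinStream.le_two_pow_of_solvesMaximin μ
    (finSumFinEquiv.trans (finCongr hMn)) A hA hM0 hγ0 hrep0 hrepm hprec u G v hG hv hκ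
  rw [← hp] at hmain
  have hNs : M * γ ≤ s := by
    refine MaximinStream.le_of_half_mul_two_pow_le hp0 ?_ hmain
    refine hMp.trans ?_
    exact_mod_cast Nat.le_mul_of_pos_right M hγ0
  have hNs' : (M : ℝ) * γ ≤ s := by exact_mod_cast hNs
  refine le_trans ?_ hNs'
  calc 1 / (4 * R) * (n / ε ^ 2) = n / 2 * (X / (2 * R)) := by
        rw [hX]
        field_simp
        ring
    _ ≤ M * γ := by gcongr
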